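/- All manifolds are smooth, finite-dimensional and without boundary, and submanifolds are embedded. Let $G$ be a Lie group acting smoothly on the left on a manifold $Q$, such that the quotient map $\pi:Q\to Q/G$ is a smooth principal $G$-bundle. For a subset $Z \subset Y$ that is a submanifold, a smooth map $f:X\to Y$ is \emph{transversal} to $Z$ if $\operatorname{im}(df(x))+T_{f(x)}Z=T_{f(x)}Y$ for all $x\in f^{-1}(Z)$; two submanifolds of $Y$ intersect transversely if the inclusion of the first is transversal to the second. A \emph{discrete connection} on $\pi$ is given by a submanifold $\mathrm{Hor}\subset Q\times Q$ that is invariant under the diagonal action of $G$ on $Q\times Q$, contains the diagonal of $Q\times Q$, and is such that $(\mathrm{id}_Q\times\pi)|_{\mathrm{Hor}}:\mathrm{Hor}\to Q\times(Q/G)$ is an injective local diffeomorphism. Proposition. Let $\mathrm{Hor}$ be a discrete connection on $\pi$. For $q\in Q$ let $i_q:Q\to Q\times Q$, $i_q(q')=(q,q')$, let $\mathrm{Hor}^2(q):=i_q^{-1}(\mathrm{Hor})\subset Q$, and let $G\cdot q$ be the orbit of $q$. Then: 1. The sets $U:=\{(q_0,g\cdot q_1): (q_0,q_1)\in\mathrm{Hor},\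 g\in G\}\subset Q\times Q$, $U':=(\mathrm{id}_Q\times\pi)(\mathrm{Hor})\subset Q\times(Q/G)$ and $U'':=(\pi\times\pi)(\mathrm{Hor})\subset (Q/G)\times(Q/G)$ are open. 2. $U$ is invariant under the product action of $G\times G$ on $Q\times Q$, and $U=(\pi\times\pi)^{-1}(U'')$. 3. For every $q\in Q$, the map $i_q$ is transversal to $\mathrm{Hor}$, and $\mathrm{Hor}^2(q)$ is a submanifold of $Q$ of dimension $\dim Q-\dim G$ (where $\dim G\le\dim Q$). 4. For every $q\in Q$, the orbit $G\cdot q$ is a submanifold of $Q$ of dimension $\dim G$, and the submanifolds $\mathrm{Hor}^2(q)$ and $G\cdot q$ intersect transversely. More precisely, $\mathrm{Hor}^2(q)\cap (G\cdot q)=\{q\}$ and $T_q\mathrm{Hor}^2(q)\oplus T_q(G\cdot q)=T_qQ$. -/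

import Mathlib

open Set Manifold
open scoped Manifold ContDiff

/-- The structure of a `d`-dimensional (embedded, smooth) submanifold on a subset `S` of a smooth
manifold `M`: `S`, with the subspace topology, is a smooth manifold of dimension `d`, and the
inclusion `S → M` is a smooth embedding. -/
structure SubmanifoldStructure {E H M : Type*} [NormedAddCommGroup E] [NormedSpace ℝ E]
    [TopologicalSpace H] (I : ModelWithCorners ℝ E H) [TopologicalSpace M] [ChartedSpace H M]
    (S : Set M) (d : ℕ) where
  charts : ChartedSpace (EuclideanSpace ℝ (Fin d)) S
  isManifold : IsManifold (𝓡 d) ∞ S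
  isSmoothEmbedding : IsSmoothEmbedding (𝓡 d) I ∞ (Subtype.val : S → M)

namespace SubmanifoldStructure

/-- The tangent space `T_x S`, as the image in `T_x M` of the derivative of the inclusion. -/
noncomputable def tangent {E H M : Type*} [NormedAddCommGroup E] [NormedSpace ℝ E]
    [TopologicalSpace H] {I : ModelWithCorners ℝ E H} [TopologicalSpace M] [ChartedSpace H M]
    {S : Set M} {d : ℕ} (σ : SubmanifoldStructure I S d) (x : S) :
    Submodule ℝ (TangentSpace I (x : M)) :=
  letI := σ.charts
  LinearMap.range (mfderiv (𝓡 d) I (Subtype.val : S → M) x).toLinearMap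

/-- The map `f : N → M` is smooth and transversal to the submanifold `S` of `M`:
`im (df(x)) + T_{f(x)} S = T_{f(x)} M` for all `x` with `f x ∈ S`. -/
def IsTransversal {E H M E' H' N : Type*} [NormedAddCommGroup E] [NormedSpace ℝ E]
    [TopologicalSpace H] {I : ModelWithCorners ℝ E H} [TopologicalSpace M] [ChartedSpace H M]
    [NormedAddCommGroup E'] [NormedSpace ℝ E'] [TopologicalSpace H']
    (J : ModelWithCorners ℝ E' H') [TopologicalSpace N] [ChartedSpace H' N]
    (f : N → M) {S : Set M} {d : ℕ} (σ : SubmanifoldStructure I S d) : Prop :=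
  ContMDiff J I ∞ f ∧
    ∀ (x : N) (hx : f x ∈ S),
      LinearMap.range (mfderiv J I f x).toLinearMap ⊔ σ.tangent ⟨f x, hx⟩ = ⊤

/-- Two submanifolds `S`, `T` of `M` intersect transversely: the inclusion of `S` is transversal
to `T`. -/
def IntersectTransversely {E H M : Type*} [NormedAddCommGroup E] [NormedSpace ℝ E]
    [TopologicalSpace H] {I : ModelWithCorners ℝ E H} [TopologicalSpace M] [ChartedSpace H M]
    {S T : Set M} {d e : ℕ} (σ : SubmanifoldStructure I S d) (τ : SubmanifoldStructure I T e) :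
    Prop :=
  letI := σ.charts
  IsTransversal (𝓡 d) (Subtype.val : S → M) τ

end SubmanifoldStructure

/-- The orbit map `π : Q → Q/G`. -/
def orbitProj (G : Type*) {Q : Type*} [Group G] [MulAction G Q] (q : Q) :
    MulAction.orbitRel.Quotient G Q :=
  Quotient.mk'' q

/-- `π : Q → Q/G` is a smooth principal `G`-bundle for the left action of `G` on `Q`: it is smoothly
and `G`-equivariantly locally trivial, where `G` acts on `V × G` by left translations of the
second factor. -/
def IsPrincipalBundle {EG HG EQ HQ EB HB : Type*}
    [NormedAddCommGroup EG] [NormedSpace ℝ EG] [TopologicalSpace HG]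
    [NormedAddCommGroup EQ] [NormedSpace ℝ EQ] [TopologicalSpace HQ]
    [NormedAddCommGroup EB] [NormedSpace ℝ EB] [TopologicalSpace HB]
    (IG : ModelWithCorners ℝ EG HG) (IQ : ModelWithCorners ℝ EQ HQ)
    (IB : ModelWithCorners ℝ EB HB)
    (G Q : Type*) [TopologicalSpace G] [ChartedSpace HG G] [Group G]
    [TopologicalSpace Q] [ChartedSpace HQ Q] [MulAction G Q]
    [ChartedSpace HB (MulAction.orbitRel.Quotient G Q)] : Prop :=
  ∀ b : MulAction.orbitRel.Quotient G Q,
    ∃ (V : Set (MulAction.orbitRel.Quotient G Q))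
      (Φ : OpenPartialHomeomorph Q (MulAction.orbitRel.Quotient G Q × G)),
      b ∈ V ∧ IsOpen V ∧
      Φ.source = orbitProj G ⁻¹' V ∧ Φ.target = V ×ˢ univ ∧
      ContMDiffOn IQ (IB.prod IG) ∞ Φ Φ.source ∧
      ContMDiffOn (IB.prod IG) IQ ∞ Φ.symm Φ.target ∧
      (∀ q ∈ Φ.source, (Φ q).1 = orbitProj G q) ∧
      (∀ q ∈ Φ.source, ∀ g : G, (Φ (g • q)).2 = g * (Φ q).2)

/-- A discrete connection on `π : Q → Q/G`: a submanifold `Hor` of `Q × Q`, invariant under the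
diagonal action and containing the diagonal, such that the restriction of `id × π` to `Hor` is an
injective local diffeomorphism into `Q × (Q/G)`. -/
structure DiscreteConnection {EQ HQ EB HB : Type*}
    [NormedAddCommGroup EQ] [NormedSpace ℝ EQ] [TopologicalSpace HQ]
    [NormedAddCommGroup EB] [NormedSpace ℝ EB] [TopologicalSpace HB]
    (IQ : ModelWithCorners ℝ EQ HQ) (IB : ModelWithCorners ℝ EB HB)
    (G Q : Type*) [Group G] [TopologicalSpace Q] [ChartedSpace HQ Q] [MulAction G Q]
    [ChartedSpace HB (MulAction.orbitRel.Quotient G Q)] where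
  Hor : Set (Q × Q)
  dim : ℕ
  submanifold : SubmanifoldStructure (IQ.prod IQ) Hor dim
  smul_mem : ∀ (g : G) (q₀ q₁ : Q), (q₀, q₁) ∈ Hor → (g • q₀, g • q₁) ∈ Hor
  diag_mem : ∀ q : Q, (q, q) ∈ Hor
  injOn : InjOn (Prod.map id (orbitProj G)) Hor
  isLocalDiffeomorph :
    letI := submanifold.charts
    IsLocalDiffeomorph (𝓡 dim) (IQ.prod IB) ∞
      (fun h : Hor => (Prod.map id (orbitProj G) (h : Q × Q)))

namespace DiscreteConnection

/-- The set `U = {(q₀, g • q₁) : (q₀, q₁) ∈ Hor, g ∈ G} ⊆ Q × Q`. -/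
def domain {EQ HQ EB HB : Type*}
    [NormedAddCommGroup EQ] [NormedSpace ℝ EQ] [TopologicalSpace HQ]
    [NormedAddCommGroup EB] [NormedSpace ℝ EB] [TopologicalSpace HB]
    {IQ : ModelWithCorners ℝ EQ HQ} {IB : ModelWithCorners ℝ EB HB}
    {G Q : Type*} [Group G] [TopologicalSpace Q] [ChartedSpace HQ Q] [MulAction G Q]
    [ChartedSpace HB (MulAction.orbitRel.Quotient G Q)]
    (A : DiscreteConnection IQ IB G Q) : Set (Q × Q) :=
  {p | ∃ (q₀ q₁ : Q) (g : G), (q₀, q₁) ∈ A.Hor ∧ p = (q₀, g • q₁)}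

/-- The horizontal slice `Hor²(q) = i_q⁻¹(Hor) = {q' : (q, q') ∈ Hor} ⊆ Q`. -/
def slice {EQ HQ EB HB : Type*}
    [NormedAddCommGroup EQ] [NormedSpace ℝ EQ] [TopologicalSpace HQ]
    [NormedAddCommGroup EB] [NormedSpace ℝ EB] [TopologicalSpace HB]
    {IQ : ModelWithCorners ℝ EQ HQ} {IB : ModelWithCorners ℝ EB HB}
    {G Q : Type*} [Group G] [TopologicalSpace Q] [ChartedSpace HQ Q] [MulAction G Q]
    [ChartedSpace HB (MulAction.orbitRel.Quotient G Q)]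
    (A : DiscreteConnection IQ IB G Q) (q : Q) : Set Q :=
  (fun q' : Q => (q, q')) ⁻¹' A.Hor

/-- The diagonal is horizontal, so `q` lies in its own horizontal slice. -/
theorem self_mem_slice {EQ HQ EB HB : Type*}
    [NormedAddCommGroup EQ] [NormedSpace ℝ EQ] [TopologicalSpace HQ]
    [NormedAddCommGroup EB] [NormedSpace ℝ EB] [TopologicalSpace HB]
    {IQ : ModelWithCorners ℝ EQ HQ} {IB : ModelWithCorners ℝ EB HB}
    {G Q : Type*} [Group G] [TopologicalSpace Q] [ChartedSpace HQ Q] [MulAction G Q]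
    [ChartedSpace HB (MulAction.orbitRel.Quotient G Q)]
    (A : DiscreteConnection IQ IB G Q) (q : Q) : q ∈ A.slice q :=
  A.diag_mem q

end DiscreteConnection

/-! Everything follows from one map. Since `(id × π)|Hor` is an injective local diffeomorphism, its
image U' is open and its inverse is a smooth horizontal lift on U' (`lift`, `contMDiffAt_lift`).
Freezing the first coordinate at `q` gives a smooth local section of π (`localSection`) whose image
is the slice Hor²(q).

Openness: U'' is the image of U' under the open map `π × id`, and U is the preimage of U''.
Transversality of `i_q`: moving the first coordinate along the lift produces vectors tangent to
`Hor` with any prescribed first component; what remains is vertical, hence in the image of `d i_q`.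

In a local trivialization the slice is the graph of a map from the base to `G`, and the orbit is a
fibre. A shear flattens the graph, so both are submanifolds by
`SubmanifoldStructure.nonempty_of_prodChart`. As a section is injective, slice and orbit meet only
at `q`. There the differentials of the section `s` and of the orbit map `o` satisfy `dπ ∘ ds = id`
and `dπ ∘ do = 0`; with the dimension count this gives complementarity (`isCompl_of_leftInverse`).
Tangent spaces are identified through velocities, so the result holds for every submanifold
structure on the two sets. -/

/-! ### Submanifold structures from flattening charts. -/

section SliceCharts

variable {E H M F : Type*} [NormedAddCommGroup E] [NormedSpace ℝ E] [TopologicalSpace H]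
  {I : ModelWithCorners ℝ E H} [TopologicalSpace M] [ChartedSpace H M]
  [NormedAddCommGroup F] [NormedSpace ℝ F] {S : Set M} {d : ℕ}

/-- A model with corners without boundary, as a homeomorphism. -/
noncomputable def ModelWithCorners.homeomorphOfBoundaryless (I : ModelWithCorners ℝ E H) [I.Boundaryless] :
    H ≃ₜ E where
  toFun := I
  invFun := I.symm
  left_inv := I.left_inv
  right_inv y := I.right_inv (by simp [I.range_eq_univ])
  continuous_toFun := I.continuous
  continuous_invFun := I.continuous_symm

/-- A diffeomorphism from an open subset of `M` onto an open subset of `ℝ^d × F` that flattens `S`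
around `x`: the points of `S` in the domain are those whose second coordinate vanishes. -/
structure SliceChart (I : ModelWithCorners ℝ E H) (F : Type*) [NormedAddCommGroup F]
    [NormedSpace ℝ F] (S : Set M) (d : ℕ) (x : S) where
  toDiffeo : PartialDiffeomorph I 𝓘(ℝ, EuclideanSpace ℝ (Fin d) × F) M
    (EuclideanSpace ℝ (Fin d) × F) ∞
  mem_source : (x : M) ∈ toDiffeo.source
  mem_iff : ∀ y ∈ toDiffeo.source, y ∈ S ↔ (toDiffeo y).2 = 0

namespace SliceChart

theorem symm_mem {x : S} (Ψ : SliceChart I F S d x) {u : EuclideanSpace ℝ (Fin d)}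
    (hu : (u, (0 : F)) ∈ Ψ.toDiffeo.target) : Ψ.toDiffeo.symm (u, 0) ∈ S := by
  refine (Ψ.mem_iff _ (Ψ.toDiffeo.map_target hu)).2 ?_
  exact congrArg Prod.snd (Ψ.toDiffeo.right_inv hu)

theorem eq_mk_zero {x : S} (Ψ : SliceChart I F S d x) {y : S}
    (hy : (y : M) ∈ Ψ.toDiffeo.source) : Ψ.toDiffeo y = ((Ψ.toDiffeo y).1, (0 : F)) :=
  Prod.ext rfl ((Ψ.mem_iff _ hy).1 y.2)

open Classical in
/-- The chart of `S` given by a slice chart of the ambient manifold. -/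
noncomputable def chart {x : S} (Ψ : SliceChart I F S d x) :
    OpenPartialHomeomorph S (EuclideanSpace ℝ (Fin d)) where
  toFun y := (Ψ.toDiffeo (y : M)).1
  -- Outside the target the value is irrelevant; `x` only supplies some point of `S`.
  invFun u := if hu : (u, (0 : F)) ∈ Ψ.toDiffeo.target then
    ⟨Ψ.toDiffeo.symm (u, 0), Ψ.symm_mem hu⟩ else x
  source := Subtype.val ⁻¹' Ψ.toDiffeo.source
  target := (fun u => (u, (0 : F))) ⁻¹' Ψ.toDiffeo.target
  map_source' y hy := by
    have := Ψ.toDiffeo.map_source hy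
    rwa [mem_preimage, ← Ψ.eq_mk_zero hy]
  map_target' u hu := by
    rw [mem_preimage] at hu
    simp only [hu, dite_true]
    exact Ψ.toDiffeo.map_target hu
  left_inv' y hy := by
    have h1 : ((Ψ.toDiffeo y).1, (0 : F)) ∈ Ψ.toDiffeo.target :=
      Ψ.eq_mk_zero hy ▸ Ψ.toDiffeo.map_source hy
    rw [dif_pos h1]
    apply Subtype.ext
    change Ψ.toDiffeo.symm ((Ψ.toDiffeo y).1, 0) = y
    rw [← Ψ.eq_mk_zero hy]
    exact Ψ.toDiffeo.left_inv hy
  right_inv' u hu := by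
    rw [mem_preimage] at hu
    rw [dif_pos hu]
    exact congrArg Prod.fst (Ψ.toDiffeo.right_inv hu)
  open_source := Ψ.toDiffeo.open_source.preimage continuous_subtype_val
  open_target := Ψ.toDiffeo.open_target.preimage (by fun_prop)
  continuousOn_toFun := continuous_fst.comp_continuousOn
    (Ψ.toDiffeo.contMDiffOn_toFun.continuousOn.comp continuous_subtype_val.continuousOn
      (fun _ h => h))
  continuousOn_invFun := by
    rw [Topology.IsInducing.subtypeVal.continuousOn_iff]
    refine ContinuousOn.congr (f := fun u => Ψ.toDiffeo.symm (u, (0 : F))) ?_ ?_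
    · exact Ψ.toDiffeo.contMDiffOn_invFun.continuousOn.comp (by fun_prop) (fun _ h => h)
    · intro u hu
      rw [mem_preimage] at hu
      simp [hu]

open Classical in
theorem coe_chart_symm {x : S} (Ψ : SliceChart I F S d x) {u : EuclideanSpace ℝ (Fin d)}
    (hu : u ∈ Ψ.chart.target) : (Ψ.chart.symm u : M) = Ψ.toDiffeo.symm (u, (0 : F)) := by
  change ((if hu : (u, (0 : F)) ∈ Ψ.toDiffeo.target then
    (⟨Ψ.toDiffeo.symm (u, 0), Ψ.symm_mem hu⟩ : S) else x : S) : M) = _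
  rw [dif_pos (show (u, (0 : F)) ∈ Ψ.toDiffeo.target from hu)]

/-- The manifold charts of `S` obtained from slice charts around all of its points. -/
@[reducible]
noncomputable def chartedSpace (Ψ : ∀ x : S, SliceChart I F S d x) :
    ChartedSpace (EuclideanSpace ℝ (Fin d)) S where
  atlas := range fun x => (Ψ x).chart
  chartAt x := (Ψ x).chart
  mem_chart_source x := (Ψ x).mem_source
  chart_mem_atlas x := mem_range_self x

/-- A transition map is `u ↦ (u, 0)` followed by an ambient smooth transition and the first
projection. -/
theorem isManifold (Ψ : ∀ x : S, SliceChart I F S d x) :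
    letI := chartedSpace Ψ
    IsManifold (𝓡 d) ∞ S := by
  let := chartedSpace Ψ
  apply isManifold_of_contDiffOn
  rintro _ _ ⟨x, rfl⟩ ⟨y, rfl⟩
  have key : ContMDiffOn 𝓘(ℝ, EuclideanSpace ℝ (Fin d)) 𝓘(ℝ, EuclideanSpace ℝ (Fin d)) ∞
      (fun u => ((Ψ y).toDiffeo ((Ψ x).toDiffeo.symm (u, (0 : F)))).1)
      ((Ψ x).chart.symm ≫ₕ (Ψ y).chart).source := by
    have h1 : ContMDiff 𝓘(ℝ, EuclideanSpace ℝ (Fin d)) 𝓘(ℝ, EuclideanSpace ℝ (Fin d) × F) ∞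
        (fun u : EuclideanSpace ℝ (Fin d) => (u, (0 : F))) :=
      (contDiff_id.prodMk contDiff_const).contMDiff
    have h2 : ContMDiff 𝓘(ℝ, EuclideanSpace ℝ (Fin d) × F) 𝓘(ℝ, EuclideanSpace ℝ (Fin d)) ∞
        (Prod.fst : EuclideanSpace ℝ (Fin d) × F → _) := contDiff_fst.contMDiff
    refine h2.comp_contMDiffOn ((Ψ y).toDiffeo.contMDiffOn_toFun.comp
      ((Ψ x).toDiffeo.contMDiffOn_invFun.comp h1.contMDiffOn fun u hu => hu.1) fun u hu => ?_)
    rw [mem_preimage, ← (Ψ x).coe_chart_symm hu.1]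
    exact hu.2
  rw [contMDiffOn_iff_contDiffOn] at key
  simp only [modelWithCornersSelf_coe, modelWithCornersSelf_coe_symm, preimage_id, range_id,
    inter_univ, CompTriple.comp_eq]
  refine key.congr fun u hu => ?_
  exact congrArg (fun z => ((Ψ y).toDiffeo z).1) ((Ψ x).coe_chart_symm hu.1)

theorem isSmoothEmbedding_val [IsManifold I ∞ M] [I.Boundaryless]
    (L : (EuclideanSpace ℝ (Fin d) × F) ≃L[ℝ] E) (Ψ : ∀ x : S, SliceChart I F S d x) :
    letI := chartedSpace Ψ
    IsSmoothEmbedding (𝓡 d) I ∞ (Subtype.val : S → M) := by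
  let := chartedSpace Ψ
  have := isManifold Ψ
  refine ⟨IsImmersionOfComplement.isImmersion (F := F) fun x => ?_,
    Topology.IsEmbedding.subtypeVal⟩
  -- An ambient chart must take values in `H`, so the slice chart is transported there by `L` and
  -- the inverse of `I`. In these charts the inclusion reads `u ↦ L (u, 0)`.
  let e : OpenPartialHomeomorph M H := (Ψ x).toDiffeo.toOpenPartialHomeomorph.transHomeomorph
    (L.toHomeomorph.trans I.homeomorphOfBoundaryless.symm)
  have hI : ContMDiff 𝓘(ℝ, E) I ∞ I.symm := by
    rw [← contMDiffOn_univ, ← I.range_eq_univ]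
    exact I.contMDiffOn_symm
  refine IsImmersionAtOfComplement.mk_of_charts L (Ψ x).chart e (Ψ x).mem_source
    (Ψ x).mem_source (IsManifold.subset_maximalAtlas (mem_range_self x)) ?_ (fun _ h => h) ?_
  · refine e.mem_maximalAtlas_of_contMDiffOn ?_ ?_
    · exact (hI.comp L.contDiff.contMDiff).comp_contMDiffOn (Ψ x).toDiffeo.contMDiffOn_toFun
    · exact (Ψ x).toDiffeo.contMDiffOn_invFun.comp
        (L.symm.contDiff.contMDiff.comp I.contMDiff).contMDiffOn fun _ h => h
  · intro u hu
    replace hu : u ∈ (Ψ x).chart.target := by simpa using hu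
    change I (I.symm (L ((Ψ x).toDiffeo ((Ψ x).chart.symm u)))) = L (u, 0)
    rw [I.right_inv (by simp [I.range_eq_univ]), (Ψ x).coe_chart_symm hu]
    exact congrArg L ((Ψ x).toDiffeo.right_inv hu)

end SliceChart

/-- A subset with slice charts around all of its points is a submanifold. -/
theorem SubmanifoldStructure.nonempty_of_sliceChart [IsManifold I ∞ M] [I.Boundaryless]
    [FiniteDimensional ℝ E] [FiniteDimensional ℝ F]
    (hd : d + Module.finrank ℝ F = Module.finrank ℝ E)
    (h : ∀ x : S, Nonempty (SliceChart I F S d x)) : Nonempty (SubmanifoldStructure I S d) := by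
  let Ψ := fun x => (h x).some
  have L : (EuclideanSpace ℝ (Fin d) × F) ≃L[ℝ] E :=
    ContinuousLinearEquiv.ofFinrankEq (by simp [hd])
  exact ⟨⟨SliceChart.chartedSpace Ψ, SliceChart.isManifold Ψ,
    SliceChart.isSmoothEmbedding_val L Ψ⟩⟩

end SliceCharts

/-! ### Submanifolds modelled on slices of a product. -/

section ProductCharts

variable {E H M EN HN N EP HP P : Type*} [NormedAddCommGroup E] [NormedSpace ℝ E]
  [TopologicalSpace H] {I : ModelWithCorners ℝ E H} [TopologicalSpace M] [ChartedSpace H M]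
  [NormedAddCommGroup EN] [NormedSpace ℝ EN] [TopologicalSpace HN] {J : ModelWithCorners ℝ EN HN}
  [TopologicalSpace N] [ChartedSpace HN N]
  [NormedAddCommGroup EP] [NormedSpace ℝ EP] [TopologicalSpace HP] {K : ModelWithCorners ℝ EP HP}
  [TopologicalSpace P] [ChartedSpace HP P]

/-- The product of a chart of `N` at `n₀`, read in the model space `V`, and a chart of `P` centred
at `p₀`. -/
noncomputable def prodExtChart [IsManifold J ∞ N] [IsManifold K ∞ P] [J.Boundaryless]
    [K.Boundaryless] {V : Type*} [NormedAddCommGroup V] [NormedSpace ℝ V] (L : EN ≃L[ℝ] V)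
    (n₀ : N) (p₀ : P) : PartialDiffeomorph (J.prod K) 𝓘(ℝ, V × EP) (N × P) (V × EP) ∞ where
  toFun z := (L (extChartAt J n₀ z.1), extChartAt K p₀ z.2 - extChartAt K p₀ p₀)
  invFun w := ((extChartAt J n₀).symm (L.symm w.1),
    (extChartAt K p₀).symm (w.2 + extChartAt K p₀ p₀))
  source := (extChartAt J n₀).source ×ˢ (extChartAt K p₀).source
  target := {w | L.symm w.1 ∈ (extChartAt J n₀).target ∧
    w.2 + extChartAt K p₀ p₀ ∈ (extChartAt K p₀).target}
  map_source' z hz := by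
    simpa only [mem_ofPred_eq, ContinuousLinearEquiv.symm_apply_apply, sub_add_cancel] using
      And.intro ((extChartAt J n₀).map_source hz.1) ((extChartAt K p₀).map_source hz.2)
  map_target' w hw := ⟨(extChartAt J n₀).map_target hw.1, (extChartAt K p₀).map_target hw.2⟩
  left_inv' z hz := by
    simp only [ContinuousLinearEquiv.symm_apply_apply, sub_add_cancel]
    exact Prod.ext ((extChartAt J n₀).left_inv hz.1) ((extChartAt K p₀).left_inv hz.2)
  right_inv' w hw := by
    rw [(extChartAt J n₀).right_inv hw.1, (extChartAt K p₀).right_inv hw.2]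
    simp
  open_source := (isOpen_extChartAt_source n₀).prod (isOpen_extChartAt_source p₀)
  open_target := ((isOpen_extChartAt_target n₀).preimage (by fun_prop)).inter
    ((isOpen_extChartAt_target p₀).preimage (by fun_prop))
  contMDiffOn_toFun := by
    refine ContMDiffOn.prodMk_space (L.contDiff.contMDiff.comp_contMDiffOn ?_) ?_
    · refine (contMDiffOn_extChartAt (n := ∞)).comp contMDiff_fst.contMDiffOn ?_
      intro z hz
      simpa using hz.1
    · refine ContMDiffOn.sub ?_ contMDiffOn_const
      refine (contMDiffOn_extChartAt (n := ∞)).comp contMDiff_snd.contMDiffOn ?_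
      intro z hz
      simpa using hz.2
  contMDiffOn_invFun := by
    refine ContMDiffOn.prodMk ?_ ?_
    · exact (contMDiffOn_extChartAt_symm n₀).comp
        (L.symm.contDiff.comp contDiff_fst).contMDiff.contMDiffOn fun w hw => hw.1
    · exact (contMDiffOn_extChartAt_symm p₀).comp
        (contDiff_snd.add contDiff_const).contMDiff.contMDiffOn fun w hw => hw.2

/-- A subset that is locally mapped by diffeomorphisms to the slices `N × {p₀}` of a product
`N × P` is a submanifold of the dimension of `N`. -/
theorem SubmanifoldStructure.nonempty_of_prodChart [IsManifold I ∞ M] [I.Boundaryless]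
    [IsManifold J ∞ N] [J.Boundaryless] [IsManifold K ∞ P] [K.Boundaryless]
    [FiniteDimensional ℝ E] [FiniteDimensional ℝ EN] [FiniteDimensional ℝ EP] {S : Set M} {d : ℕ}
    (hd : Module.finrank ℝ EN = d)
    (hdim : Module.finrank ℝ EN + Module.finrank ℝ EP = Module.finrank ℝ E)
    (h : ∀ x ∈ S, ∃ (Φ : PartialDiffeomorph I (J.prod K) M (N × P) ∞) (p₀ : P), x ∈ Φ.source ∧
      ∀ y ∈ Φ.source, y ∈ S ↔ (Φ y).2 = p₀) :
    Nonempty (SubmanifoldStructure I S d) := by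
  refine nonempty_of_sliceChart (F := EP) (by rw [← hd, hdim]) fun ⟨x, hx⟩ => ?_
  obtain ⟨Φ, p₀, hxΦ, hS⟩ := h x hx
  have L : EN ≃L[ℝ] EuclideanSpace ℝ (Fin d) := ContinuousLinearEquiv.ofFinrankEq (by simp [hd])
  refine ⟨⟨Φ.trans (prodExtChart L (Φ x).1 p₀), ⟨hxΦ, ?_⟩, fun y hy => ?_⟩⟩
  · refine ⟨mem_extChartAt_source _, ?_⟩
    change (Φ x).2 ∈ (extChartAt K p₀).source
    rw [(hS x hxΦ).1 hx]
    exact mem_extChartAt_source _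
  · rw [hS y hy.1]
    change (Φ y).2 = p₀ ↔ extChartAt K p₀ (Φ y).2 - extChartAt K p₀ p₀ = 0
    rw [sub_eq_zero]
    exact ((extChartAt K p₀).injOn.eq_iff hy.2.2 (mem_extChartAt_source _)).symm

end ProductCharts

/-! ### Tangent spaces of submanifolds as spaces of velocities. -/

namespace SubmanifoldStructure

variable {E H M E' H' N : Type*} [NormedAddCommGroup E] [NormedSpace ℝ E]
  [TopologicalSpace H] {I : ModelWithCorners ℝ E H} [TopologicalSpace M] [ChartedSpace H M]
  [NormedAddCommGroup E'] [NormedSpace ℝ E'] [TopologicalSpace H'] {J : ModelWithCorners ℝ E' H'}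
  [TopologicalSpace N] [ChartedSpace H' N] {S : Set M} {d : ℕ}

open Filter Topology

open Classical in
/-- The velocities of a smooth map with values in a submanifold are tangent to it. -/
theorem mfderiv_mem_tangent (σ : SubmanifoldStructure I S d) {γ : N → M} {z : N}
    (hγ : ContMDiffAt J I ∞ γ z) (hS : ∀ᶠ w in 𝓝 z, γ w ∈ S) {x : S} (hx : γ z = x)
    (v : TangentSpace J z) : mfderiv J I γ z v ∈ σ.tangent x := by
  let := σ.charts
  let g : N → S := fun w => if h : γ w ∈ S then ⟨γ w, h⟩ else x
  have hg : Subtype.val ∘ g =ᶠ[𝓝 z] γ := by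
    filter_upwards [hS] with w hw
    simp [g, hw]
  have hgz : g z = x := Subtype.ext (hg.self_of_nhds.trans hx)
  have himm := σ.isSmoothEmbedding.isImmersion
  have hgs : ContMDiffAt J (𝓡 d) ∞ g z := by
    -- The inclusion is an immersion, so a continuous map into `S` is smooth once its composite with
    -- the inclusion is; continuity comes from the subspace topology.
    rw [ContMDiffAt.iff_comp_isImmersionAt (himm.isImmersionAt (g z))]
    exact ⟨Topology.IsInducing.subtypeVal.continuousAt_iff.2
      (hγ.continuousAt.congr hg.symm), hγ.congr_of_eventuallyEq hg⟩
  have hcomp := mfderiv_comp z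
    (himm.contMDiff.mdifferentiableAt (x := g z) (by simp)) (hgs.mdifferentiableAt (by simp))
  rw [hg.mfderiv_eq] at hcomp
  have hmem : mfderiv J I γ z v ∈ σ.tangent (g z) :=
    ⟨mfderiv J (𝓡 d) g z v, (congrArg (fun f => f v) hcomp).symm⟩
  exact hgz ▸ hmem

/-- If a submanifold is locally the image of `γ`, with smooth local left inverse `ρ` of `γ` defined
on the ambient manifold, then all of its tangent vectors are velocities of `γ`. -/
theorem exists_mfderiv_eq_of_mem_tangent (σ : SubmanifoldStructure I S d) {γ : N → M} {z : N}
    {ρ : M → N} {x : S} (hγ : MDifferentiableAt J I γ z) (hρ : MDifferentiableAt I J ρ (x : M))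
    (hx : ρ x = z) (hS : ∀ᶠ y in 𝓝 (x : M), y ∈ S → γ (ρ y) = y) {v : TangentSpace I (x : M)}
    (hv : v ∈ σ.tangent x) : ∃ u : TangentSpace J z, mfderiv J I γ z u = v := by
  let := σ.charts
  obtain ⟨w, rfl⟩ := hv
  have hval : MDifferentiableAt (𝓡 d) I (Subtype.val : S → M) x :=
    σ.isSmoothEmbedding.isImmersion.contMDiff.mdifferentiableAt (by simp)
  -- The inclusion factors locally through `γ`; differentiating this factorization gives the
  -- preimage `u`.
  have heq : γ ∘ (ρ ∘ (Subtype.val : S → M)) =ᶠ[𝓝 x] Subtype.val := by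
    filter_upwards [continuous_subtype_val.continuousAt.eventually hS] with y hy using hy y.2
  subst hx
  have h1 := mfderiv_comp x (g := γ) (f := ρ ∘ (Subtype.val : S → M)) hγ (hρ.comp x hval)
  rw [heq.mfderiv_eq] at h1
  exact ⟨mfderiv (𝓡 d) J (ρ ∘ (Subtype.val : S → M)) x w, (congrArg (fun f => f w) h1).symm⟩

end SubmanifoldStructure

/-! ### Differentials of composites, and a criterion for complements. -/

section Calculus

open Filter Topology

variable {E H M E' H' N : Type*} [NormedAddCommGroup E] [NormedSpace ℝ E]
  [TopologicalSpace H] {I : ModelWithCorners ℝ E H} [TopologicalSpace M] [ChartedSpace H M]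
  [NormedAddCommGroup E'] [NormedSpace ℝ E'] [TopologicalSpace H'] {J : ModelWithCorners ℝ E' H'}
  [TopologicalSpace N] [ChartedSpace H' N]

/-- The derivative of a local left inverse of `γ` is a left inverse of the derivative of `γ`. -/
theorem mfderiv_apply_mfderiv_of_leftInverse {γ : N → M} {ρ : M → N} {z : N} {x : M}
    (hγ : MDifferentiableAt J I γ z) (hρ : MDifferentiableAt I J ρ x) (hx : γ z = x)
    (h : ∀ᶠ w in 𝓝 z, ρ (γ w) = w) (u : TangentSpace J z) :
    mfderiv I J ρ x (mfderiv J I γ z u) = u := by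
  subst hx
  have h1 := mfderiv_comp z hρ hγ
  have h2 : ρ ∘ γ =ᶠ[𝓝 z] id := h
  rw [h2.mfderiv_eq, mfderiv_id] at h1
  exact (congrArg (fun f => f u) h1).symm

/-- The derivatives of two maps with constant composition compose to zero. -/
theorem mfderiv_apply_mfderiv_of_comp_const {E'' H'' P : Type*} [NormedAddCommGroup E'']
    [NormedSpace ℝ E''] [TopologicalSpace H''] {K : ModelWithCorners ℝ E'' H''}
    [TopologicalSpace P] [ChartedSpace H'' P] {γ : N → M} {ρ : M → P} {z : N} {x : M} {c : P}
    (hγ : MDifferentiableAt J I γ z) (hρ : MDifferentiableAt I K ρ x) (hx : γ z = x)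
    (h : ∀ w, ρ (γ w) = c) (u : TangentSpace J z) :
    mfderiv I K ρ x (mfderiv J I γ z u) = 0 := by
  subst hx
  have h1 := mfderiv_comp z hρ hγ
  rw [show ρ ∘ γ = fun _ => c from funext h, mfderiv_const] at h1
  exact (congrArg (fun f => f u) h1).symm

/-- Manifolds that are diffeomorphic near a point have the same dimension. -/
theorem PartialDiffeomorph.finrank_eq (Φ : PartialDiffeomorph I J M N ∞) {x : M}
    (hx : x ∈ Φ.source) : Module.finrank ℝ E = Module.finrank ℝ E' :=
  ((Φ.isLocalDiffeomorphAt I J ∞ hx).mfderivToContinuousLinearEquiv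
    (by simp)).toLinearEquiv.finrank_eq

end Calculus

/-- Two subspaces are complementary if they are the images of maps `α`, `β` with left inverses `p`,
`r` such that `p` vanishes on the second one, and the dimensions add up. -/
theorem isCompl_of_leftInverse {V X Y : Type*} [AddCommGroup V] [Module ℝ V]
    [FiniteDimensional ℝ V] [AddCommGroup X] [Module ℝ X] [AddCommGroup Y] [Module ℝ Y]
    {S T : Submodule ℝ V} (α : X →ₗ[ℝ] V) (β : Y →ₗ[ℝ] V) (p : V →ₗ[ℝ] X) (r : V →ₗ[ℝ] Y)
    (hα : ∀ u, α u ∈ S) (hS : ∀ v ∈ S, ∃ u, α u = v)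
    (hβ : ∀ w, β w ∈ T) (hT : ∀ v ∈ T, ∃ w, β w = v)
    (hp : ∀ u, p (α u) = u) (hr : ∀ w, r (β w) = w) (hpβ : ∀ w, p (β w) = 0)
    (hdim : Module.finrank ℝ X + Module.finrank ℝ Y = Module.finrank ℝ V) : IsCompl S T := by
  have h1 : Module.finrank ℝ X ≤ Module.finrank ℝ S :=
    LinearMap.finrank_le_finrank_of_injective (f := α.codRestrict S hα)
      (fun a b h => Function.LeftInverse.injective hp (congrArg Subtype.val h))
  have h2 : Module.finrank ℝ Y ≤ Module.finrank ℝ T :=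
    LinearMap.finrank_le_finrank_of_injective (f := β.codRestrict T hβ)
      (fun a b h => Function.LeftInverse.injective hr (congrArg Subtype.val h))
  -- The left inverses make `α` and `β` injective, so the dimensions of `S` and `T` add up to at
  -- least that of `V`; disjointness then suffices.
  rw [Submodule.isCompl_iff_disjoint _ _ (by omega), Submodule.disjoint_def]
  intro v hvS hvT
  obtain ⟨u, rfl⟩ := hS v hvS
  obtain ⟨w, hw⟩ := hT _ hvT
  have : u = 0 := by rw [← hp u, ← hw, hpβ]
  rw [this, map_zero]

/-! ### The orbit projection and principal bundles. -/

theorem orbitProj_eq_iff {G Q : Type*} [Group G] [MulAction G Q] {q q' : Q} :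
    orbitProj G q = orbitProj G q' ↔ q ∈ MulAction.orbit G q' :=
  Quotient.eq''

theorem orbitProj_smul {G Q : Type*} [Group G] [MulAction G Q] (g : G) (q : Q) :
    orbitProj G (g • q) = orbitProj G q :=
  orbitProj_eq_iff.2 (MulAction.mem_orbit q g)

section PrincipalBundle

variable {EG HG EQ HQ EB HB : Type*}
    [NormedAddCommGroup EG] [NormedSpace ℝ EG] [TopologicalSpace HG]
    [NormedAddCommGroup EQ] [NormedSpace ℝ EQ] [TopologicalSpace HQ]
    [NormedAddCommGroup EB] [NormedSpace ℝ EB] [TopologicalSpace HB]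
    {IG : ModelWithCorners ℝ EG HG} {IQ : ModelWithCorners ℝ EQ HQ}
    {IB : ModelWithCorners ℝ EB HB}
    {G Q : Type*} [TopologicalSpace G] [ChartedSpace HG G] [Group G]
    [TopologicalSpace Q] [ChartedSpace HQ Q] [MulAction G Q]
    [ChartedSpace HB (MulAction.orbitRel.Quotient G Q)]

namespace IsPrincipalBundle

/-- A local trivialization around the orbit of `q`, as a diffeomorphism of open subsets. -/
theorem exists_partialDiffeomorph (hπ : IsPrincipalBundle IG IQ IB G Q) (q : Q) :
    ∃ (V : Set (MulAction.orbitRel.Quotient G Q))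
      (Φ : PartialDiffeomorph IQ (IB.prod IG) Q (MulAction.orbitRel.Quotient G Q × G) ∞),
      orbitProj G q ∈ V ∧ IsOpen V ∧ Φ.source = orbitProj G ⁻¹' V ∧ Φ.target = V ×ˢ univ ∧
      (∀ y ∈ Φ.source, (Φ y).1 = orbitProj G y) ∧
      (∀ y ∈ Φ.source, ∀ g : G, (Φ (g • y)).2 = g * (Φ y).2) := by
  obtain ⟨V, Φ, hb, hV, hs, ht, h1, h2, h3, h4⟩ := hπ (orbitProj G q)
  exact ⟨V, ⟨Φ.toPartialEquiv, Φ.open_source, Φ.open_target, h1, h2⟩, hb, hV, hs, ht, h3, h4⟩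

theorem contMDiff_orbitProj (hπ : IsPrincipalBundle IG IQ IB G Q) :
    ContMDiff IQ IB ∞ (orbitProj G : Q → _) := by
  intro q
  obtain ⟨V, Φ, hb, -, hs, -, h, -⟩ := hπ.exists_partialDiffeomorph q
  have hq : q ∈ Φ.source := by rw [hs]; exact hb
  refine ((contMDiff_fst.comp_contMDiffOn Φ.contMDiffOn).contMDiffAt
    (Φ.open_source.mem_nhds hq)).congr_of_eventuallyEq ?_
  filter_upwards [Φ.open_source.mem_nhds hq] with y hy using (h y hy).symm

/-- A trivialization is a diffeomorphism near `q` onto an open subset of the base times `G`; the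
point `q` guarantees that its domain is nonempty. -/
theorem finrank_add_finrank (hπ : IsPrincipalBundle IG IQ IB G Q) [FiniteDimensional ℝ EG]
    [FiniteDimensional ℝ EB] (q : Q) :
    Module.finrank ℝ EB + Module.finrank ℝ EG = Module.finrank ℝ EQ := by
  obtain ⟨V, Φ, hb, -, hs, -⟩ := hπ.exists_partialDiffeomorph q
  rw [Φ.finrank_eq (x := q) (by rw [hs]; exact hb), Module.finrank_prod]

/-- The orbits of a principal bundle are submanifolds of the dimension of the group. -/
theorem nonempty_submanifoldStructure_orbit (hπ : IsPrincipalBundle IG IQ IB G Q)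
    [FiniteDimensional ℝ EG] [FiniteDimensional ℝ EQ] [FiniteDimensional ℝ EB]
    [IG.Boundaryless] [IQ.Boundaryless] [IB.Boundaryless] [IsManifold IG ∞ G] [IsManifold IQ ∞ Q]
    [IsManifold IB ∞ (MulAction.orbitRel.Quotient G Q)] (q : Q) :
    Nonempty (SubmanifoldStructure IQ (MulAction.orbit G q) (Module.finrank ℝ EG)) := by
  refine SubmanifoldStructure.nonempty_of_prodChart (J := IG) (N := G) (K := IB)
    (P := MulAction.orbitRel.Quotient G Q) rfl
    (by rw [add_comm, hπ.finrank_add_finrank q]) fun x _ => ?_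
  obtain ⟨V, Φ, hb, -, hs, -, h, -⟩ := hπ.exists_partialDiffeomorph x
  -- The factors are swapped so that the orbit, a fibre of π, becomes `G × {point}`.
  refine ⟨Φ.trans (Diffeomorph.prodComm IB IG _ G ∞).toPartialDiffeomorph, orbitProj G q,
    ⟨show x ∈ Φ.source by rw [hs]; exact hb, mem_univ _⟩, fun y hy => ?_⟩
  rw [← orbitProj_eq_iff, ← h y hy.1]
  rfl

end IsPrincipalBundle

end PrincipalBundle

/-- The shear `(b, g) ↦ (b, σ(b)⁻¹ g)` along a smooth map `σ` with values in a Lie group. -/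
def PartialDiffeomorph.shear {EG HG EB HB G B : Type*}
    [NormedAddCommGroup EG] [NormedSpace ℝ EG] [TopologicalSpace HG]
    [NormedAddCommGroup EB] [NormedSpace ℝ EB] [TopologicalSpace HB]
    {IG : ModelWithCorners ℝ EG HG} {IB : ModelWithCorners ℝ EB HB}
    [TopologicalSpace G] [ChartedSpace HG G] [Group G] [LieGroup IG ∞ G]
    [TopologicalSpace B] [ChartedSpace HB B] {W : Set B} (hW : IsOpen W) {σ : B → G}
    (hσ : ContMDiffOn IB IG ∞ σ W) :
    PartialDiffeomorph (IB.prod IG) (IB.prod IG) (B × G) (B × G) ∞ where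
  toFun z := (z.1, (σ z.1)⁻¹ * z.2)
  invFun z := (z.1, σ z.1 * z.2)
  source := W ×ˢ univ
  target := W ×ˢ univ
  map_source' _ hz := ⟨hz.1, mem_univ _⟩
  map_target' _ hz := ⟨hz.1, mem_univ _⟩
  left_inv' z _ := by simp
  right_inv' z _ := by simp
  open_source := hW.prod isOpen_univ
  open_target := hW.prod isOpen_univ
  contMDiffOn_toFun := contMDiff_fst.contMDiffOn.prodMk
    ((hσ.comp contMDiff_fst.contMDiffOn fun _ hz => hz.1).inv.mul contMDiff_snd.contMDiffOn)
  contMDiffOn_invFun := contMDiff_fst.contMDiffOn.prodMk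
    ((hσ.comp contMDiff_fst.contMDiffOn fun _ hz => hz.1).mul contMDiff_snd.contMDiffOn)

/-! ### The horizontal lift and its consequences. -/

namespace DiscreteConnection

open Filter Topology

section Basic

variable {EQ HQ EB HB : Type*}
    [NormedAddCommGroup EQ] [NormedSpace ℝ EQ] [TopologicalSpace HQ]
    [NormedAddCommGroup EB] [NormedSpace ℝ EB] [TopologicalSpace HB]
    {IQ : ModelWithCorners ℝ EQ HQ} {IB : ModelWithCorners ℝ EB HB}
    {G Q : Type*} [Group G] [TopologicalSpace Q] [ChartedSpace HQ Q] [MulAction G Q]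
    [ChartedSpace HB (MulAction.orbitRel.Quotient G Q)]
    (A : DiscreteConnection IQ IB G Q)

/-- The image `(id × π)(Hor)` of the horizontal submanifold in `Q × Q/G`. -/
def mixedDomain : Set (Q × MulAction.orbitRel.Quotient G Q) :=
  Prod.map id (orbitProj G) '' A.Hor

theorem isOpen_mixedDomain : IsOpen A.mixedDomain := by
  let := A.submanifold.charts
  have := A.isLocalDiffeomorph.isOpen_range
  rwa [show A.mixedDomain = range _ from (image_eq_range _ _)]

theorem mk_mem_mixedDomain {q q' : Q} (h : (q, q') ∈ A.Hor) :
    (q, orbitProj G q') ∈ A.mixedDomain :=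
  mem_image_of_mem _ h

open Classical in
/-- The horizontal lift: the inverse of `(id × π)|Hor` on its image, extended by the diagonal. -/
noncomputable def lift (p : Q × MulAction.orbitRel.Quotient G Q) : Q × Q :=
  if h : p ∈ A.mixedDomain then h.choose else (p.1, p.1)

/-- Unconditional because the default value lies on the diagonal; this lets later arguments avoid
restricting to neighbourhoods. -/
theorem lift_mem (p : Q × MulAction.orbitRel.Quotient G Q) : A.lift p ∈ A.Hor := by
  unfold lift
  split_ifs with h
  · exact h.choose_spec.1
  · exact A.diag_mem _

theorem map_lift {p : Q × MulAction.orbitRel.Quotient G Q} (hp : p ∈ A.mixedDomain) :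
    Prod.map id (orbitProj G) (A.lift p) = p := by
  rw [lift, dif_pos hp]
  exact hp.choose_spec.2

theorem lift_fst (p : Q × MulAction.orbitRel.Quotient G Q) : (A.lift p).1 = p.1 := by
  by_cases hp : p ∈ A.mixedDomain
  · exact congrArg Prod.fst (A.map_lift hp)
  · rw [lift, dif_neg hp]

theorem lift_map {h : Q × Q} (hh : h ∈ A.Hor) : A.lift (Prod.map id (orbitProj G) h) = h :=
  A.injOn (A.lift_mem _) hh (A.map_lift (mem_image_of_mem _ hh))

/-- Near `p` the lift is a smooth local inverse of `(id × π)|Hor` followed by the inclusion of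
`Hor`; injectivity forces the two to agree. -/
theorem contMDiffAt_lift {p : Q × MulAction.orbitRel.Quotient G Q} (hp : p ∈ A.mixedDomain) :
    ContMDiffAt (IQ.prod IB) (IQ.prod IQ) ∞ A.lift p := by
  let := A.submanifold.charts
  obtain ⟨h, hh, rfl⟩ := hp
  have hloc := A.isLocalDiffeomorph ⟨h, hh⟩
  refine (A.submanifold.isSmoothEmbedding.contMDiff.contMDiffAt.comp _
    hloc.localInverse_contMDiffAt).congr_of_eventuallyEq ?_
  filter_upwards [hloc.localInverse.open_source.mem_nhds hloc.localInverse_mem_source] with y hy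
  rw [Function.comp_apply, ← A.lift_map (hloc.localInverse y).2]
  exact congrArg A.lift (hloc.localInverse_right_inv hy).symm

/-- The horizontal local section of `π` through `q`, whose image is the horizontal slice. -/
noncomputable def localSection (q : Q) (b : MulAction.orbitRel.Quotient G Q) : Q :=
  (A.lift (q, b)).2

theorem localSection_mem_slice (q : Q) (b : MulAction.orbitRel.Quotient G Q) :
    A.localSection q b ∈ A.slice q := by
  have := A.lift_mem (q, b)
  rwa [← Prod.mk.eta (p := A.lift (q, b)), A.lift_fst] at this

theorem orbitProj_localSection {q : Q} {b : MulAction.orbitRel.Quotient G Q}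
    (h : (q, b) ∈ A.mixedDomain) : orbitProj G (A.localSection q b) = b :=
  congrArg Prod.snd (A.map_lift h)

theorem localSection_orbitProj {q q' : Q} (h : q' ∈ A.slice q) :
    A.localSection q (orbitProj G q') = q' :=
  congrArg Prod.snd (A.lift_map (h : (q, q') ∈ A.Hor))

theorem contMDiffAt_localSection {q : Q} {b : MulAction.orbitRel.Quotient G Q}
    (h : (q, b) ∈ A.mixedDomain) : ContMDiffAt IB IQ ∞ (A.localSection q) b :=
  contMDiffAt_snd.comp b ((A.contMDiffAt_lift h).comp b
    (contMDiffAt_const.prodMk contMDiffAt_id))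

theorem domain_eq_preimage :
    A.domain = Prod.map (orbitProj G) (orbitProj G) ⁻¹'
      (Prod.map (orbitProj G) (orbitProj G) '' A.Hor) := by
  ext ⟨q₀, q₁⟩
  constructor
  · rintro ⟨r₀, r₁, g, h, heq⟩
    obtain ⟨rfl, rfl⟩ := Prod.mk.inj heq
    exact ⟨_, h, Prod.ext rfl (orbitProj_smul g r₁).symm⟩
  · rintro ⟨⟨r₀, r₁⟩, h, heq⟩
    obtain ⟨h₀, h₁⟩ := Prod.mk.inj heq
    obtain ⟨g, rfl⟩ := orbitProj_eq_iff.1 h₀.symm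
    obtain ⟨k, rfl⟩ := orbitProj_eq_iff.1 h₁.symm
    -- Here the given point is `(g • r₀, k • r₁)`. Diagonal invariance moves `(r₀, r₁)` by `g`, and
    -- `k * g⁻¹` corrects the second entry.
    exact ⟨g • r₀, g • r₁, k * g⁻¹, A.smul_mem g _ _ h, by simp [mul_smul]⟩

theorem smul_mem_domain (g₀ g₁ : G) {q₀ q₁ : Q} (h : (q₀, q₁) ∈ A.domain) :
    (g₀ • q₀, g₁ • q₁) ∈ A.domain := by
  rw [domain_eq_preimage] at h ⊢
  rwa [mem_preimage, Prod.map_apply, orbitProj_smul, orbitProj_smul]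

/-- A point of the slice is recovered from its orbit by the local section, so π is injective on the
slice. -/
theorem slice_inter_orbit (q : Q) : A.slice q ∩ MulAction.orbit G q = {q} := by
  refine Subset.antisymm ?_ (singleton_subset_iff.2
    ⟨A.self_mem_slice q, MulAction.mem_orbit_self q⟩)
  rintro x ⟨hx, hxq⟩
  rw [mem_singleton_iff, ← A.localSection_orbitProj hx, orbitProj_eq_iff.2 hxq,
    A.localSection_orbitProj (A.self_mem_slice q)]

theorem isOpenMap_orbitProj [ContinuousConstSMul G Q] : IsOpenMap (orbitProj G : Q → _) :=
  isOpenMap_quotient_mk'_mul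

theorem isOpen_image_prodMap_orbitProj [ContinuousConstSMul G Q] :
    IsOpen (Prod.map (orbitProj G) (orbitProj G) '' A.Hor) := by
  have := ((isOpenMap_orbitProj (G := G) (Q := Q)).prodMap IsOpenMap.id) _ A.isOpen_mixedDomain
  rwa [mixedDomain, ← image_comp, Prod.map_comp_map] at this

theorem isOpen_domain [ContinuousConstSMul G Q] : IsOpen A.domain := by
  rw [domain_eq_preimage]
  have h : Continuous (orbitProj G : Q → _) := continuous_quotient_mk'
  exact A.isOpen_image_prodMap_orbitProj.preimage (h.prodMap h)

/-- The maps `q' ↦ (q, q')` are transversal to the horizontal submanifold. -/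
theorem isTransversal_mk [IsManifold IQ ∞ Q] (q : Q) :
    SubmanifoldStructure.IsTransversal IQ (fun q' : Q => (q, q')) A.submanifold := by
  refine ⟨contMDiff_const.prodMk contMDiff_id, fun q' hx => ?_⟩
  have hlift : ContMDiffAt IQ (IQ.prod IQ) ∞ (fun y => A.lift (y, orbitProj G q')) q :=
    (A.contMDiffAt_lift (A.mk_mem_mixedDomain hx)).comp q (contMDiffAt_id.prodMk contMDiffAt_const)
  have hz : A.lift (q, orbitProj G q') = (q, q') := A.lift_map hx
  rw [eq_top_iff]
  intro v _
  let w := mfderiv IQ (IQ.prod IQ) (fun y => A.lift (y, orbitProj G q')) q v.1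
  have hw : w ∈ A.submanifold.tangent ⟨(q, q'), hx⟩ :=
    A.submanifold.mfderiv_mem_tangent hlift (Eventually.of_forall fun y => A.lift_mem _) hz _
  have hw1 : w.1 = v.1 := by
    have := mfderiv_apply_mfderiv_of_leftInverse (hlift.mdifferentiableAt (by simp))
      (mdifferentiableAt_fst (I := IQ) (I' := IQ)) hz
      (Eventually.of_forall fun y => A.lift_fst _) v.1
    rwa [mfderiv_fst] at this
  -- `w` is tangent to `Hor` and has the first component of `v`, so `v - w = (0, v.2 - w.2)` lies in
  -- the image of `d i_q`.
  refine Submodule.mem_sup.2 ⟨(0, v.2 - w.2), ⟨v.2 - w.2, ?_⟩, w, hw, ?_⟩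
  · change mfderiv IQ (IQ.prod IQ) (fun q' : Q => (q, q')) q' (v.2 - w.2) = _
    rw [mfderiv_prod_right]
    rfl
  · refine Prod.ext ?_ ?_
    · exact (zero_add _).trans hw1
    · exact sub_add_cancel _ _

end Basic

/-! ### Horizontal slices and orbits in a principal bundle. -/

section Bundle

variable {EG HG EQ HQ EB HB : Type*}
    [NormedAddCommGroup EG] [NormedSpace ℝ EG] [FiniteDimensional ℝ EG] [TopologicalSpace HG]
    [NormedAddCommGroup EQ] [NormedSpace ℝ EQ] [FiniteDimensional ℝ EQ] [TopologicalSpace HQ]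
    [NormedAddCommGroup EB] [NormedSpace ℝ EB] [FiniteDimensional ℝ EB] [TopologicalSpace HB]
    {IG : ModelWithCorners ℝ EG HG} {IQ : ModelWithCorners ℝ EQ HQ}
    {IB : ModelWithCorners ℝ EB HB}
    {G Q : Type*} [TopologicalSpace G] [ChartedSpace HG G] [Group G] [LieGroup IG ∞ G]
    [TopologicalSpace Q] [ChartedSpace HQ Q] [MulAction G Q]
    [ChartedSpace HB (MulAction.orbitRel.Quotient G Q)]

/-- The horizontal slices are submanifolds of the dimension of the base. -/
theorem nonempty_submanifoldStructure_slice
    [IG.Boundaryless] [IQ.Boundaryless] [IB.Boundaryless] [IsManifold IQ ∞ Q]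
    [IsManifold IB ∞ (MulAction.orbitRel.Quotient G Q)]
    (hπ : IsPrincipalBundle IG IQ IB G Q) (A : DiscreteConnection IQ IB G Q) (q : Q) :
    Nonempty (SubmanifoldStructure IQ (A.slice q)
      (Module.finrank ℝ EQ - Module.finrank ℝ EG)) := by
  have hdim := hπ.finrank_add_finrank q
  have : IsManifold IG ∞ G := (inferInstance : ContMDiffMul IG ∞ G).toIsManifold
  refine SubmanifoldStructure.nonempty_of_prodChart (J := IB)
    (N := MulAction.orbitRel.Quotient G Q) (K := IG) (P := G) (by omega) hdim fun x hx => ?_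
  obtain ⟨V, Φ, hb, hV, hs, -, hΦ, -⟩ := hπ.exists_partialDiffeomorph x
  have hdom : IsOpen {b | (q, b) ∈ A.mixedDomain} := A.isOpen_mixedDomain.preimage (by fun_prop)
  have hmem : ∀ b ∈ V ∩ {b | (q, b) ∈ A.mixedDomain}, A.localSection q b ∈ Φ.source := by
    intro b hb
    rw [hs, mem_preimage, A.orbitProj_localSection hb.2]
    exact hb.1
  -- This is the `G`-coordinate of the section; the slice is its graph, and the shear moves that
  -- graph to `G`-coordinate `1`.
  have hσ : ContMDiffOn IB IG ∞ (fun b => (Φ (A.localSection q b)).2)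
      (V ∩ {b | (q, b) ∈ A.mixedDomain}) :=
    contMDiff_snd.comp_contMDiffOn (Φ.contMDiffOn.comp
      (fun b hb => (A.contMDiffAt_localSection hb.2).contMDiffWithinAt) hmem)
  refine ⟨Φ.trans (PartialDiffeomorph.shear (hV.inter hdom) hσ), 1, ⟨?_, ?_⟩, ?_⟩
  · change x ∈ Φ.source
    rw [hs]
    exact hb
  · have hx' : x ∈ Φ.source := by rw [hs]; exact hb
    refine ⟨?_, mem_univ _⟩
    change (Φ x).1 ∈ _
    rw [hΦ x hx']
    exact ⟨hb, A.mk_mem_mixedDomain hx⟩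
  · rintro y ⟨hy : y ∈ Φ.source, hyW, -⟩
    change (Φ y).1 ∈ _ at hyW
    change _ ↔ (Φ (A.localSection q (Φ y).1)).2⁻¹ * (Φ y).2 = 1
    rw [hΦ y hy] at hyW ⊢
    rw [inv_mul_eq_one]
    constructor
    · intro h
      rw [A.localSection_orbitProj h]
    · intro h
      have : A.localSection q (orbitProj G y) = y := by
        -- The two points lie over the same base point and have the same `G`-coordinate.
        refine Φ.injOn (hmem _ hyW) hy (Prod.ext ?_ h)
        exact (hΦ _ (hmem _ hyW)).trans ((A.orbitProj_localSection hyW.2).trans (hΦ y hy).symm)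
      rw [← this]
      exact A.localSection_mem_slice _ _

/-- The tangent spaces of the horizontal slice through `q` and of the orbit of `q` are complementary
at `q`. -/
theorem isCompl_tangent [ContMDiffSMul IG IQ ∞ G Q]
    (hπ : IsPrincipalBundle IG IQ IB G Q) (A : DiscreteConnection IQ IB G Q) (q : Q) {d e : ℕ}
    (σ : SubmanifoldStructure IQ (A.slice q) d)
    (τ : SubmanifoldStructure IQ (MulAction.orbit G q) e) :
    IsCompl (σ.tangent ⟨q, A.self_mem_slice q⟩) (τ.tangent ⟨q, MulAction.mem_orbit_self q⟩) := by
  have hmem : (q, orbitProj G q) ∈ A.mixedDomain := A.mk_mem_mixedDomain (A.self_mem_slice q)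
  have hmem' : ∀ᶠ b in 𝓝 (orbitProj G q), (q, b) ∈ A.mixedDomain :=
    (A.isOpen_mixedDomain.preimage (f := fun b => (q, b)) (by fun_prop)).mem_nhds hmem
  have hs := A.contMDiffAt_localSection hmem
  have hsq : A.localSection q (orbitProj G q) = q := A.localSection_orbitProj (A.self_mem_slice q)
  have hp : MDifferentiableAt IQ IB (orbitProj G) q :=
    hπ.contMDiff_orbitProj.mdifferentiableAt (by simp)
  have ho : ContMDiffAt IG IQ ∞ (fun g : G => g • q) 1 :=
    (contMDiff_smul (I := IG) (I' := IQ)).contMDiffAt.comp 1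
      (contMDiffAt_id.prodMk contMDiffAt_const)
  obtain ⟨V, Φ, hb, hV, hsrc, -, hΦ, hΦG⟩ := hπ.exists_partialDiffeomorph q
  have hq : q ∈ Φ.source := by rw [hsrc]; exact hb
  -- By equivariance, dividing by the `G`-coordinate of `q` turns the trivialization into a left
  -- inverse of the orbit map `g ↦ g • q`.
  have hρ : MDifferentiableAt IQ IG (fun y => (Φ y).2 * (Φ q).2⁻¹) q :=
    (((contMDiff_snd.comp_contMDiffOn Φ.contMDiffOn).contMDiffAt (Φ.open_source.mem_nhds hq)).mul
      contMDiffAt_const).mdifferentiableAt (n := ∞) (by simp)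
  have hρo : ∀ g : G, (Φ (g • q)).2 * (Φ q).2⁻¹ = g := fun g => by rw [hΦG q hq]; simp
  refine isCompl_of_leftInverse (V := EQ) (X := EB) (Y := EG)
    (mfderiv IB IQ (A.localSection q) (orbitProj G q)).toLinearMap
    (mfderiv IG IQ (fun g : G => g • q) 1).toLinearMap
    (mfderiv IQ IB (orbitProj G) q).toLinearMap
    (mfderiv IQ IG (fun y => (Φ y).2 * (Φ q).2⁻¹) q).toLinearMap ?_ ?_ ?_ ?_ ?_ ?_ ?_
    (hπ.finrank_add_finrank q)
  · exact σ.mfderiv_mem_tangent hs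
      (Eventually.of_forall fun b => A.localSection_mem_slice q b) hsq
  · intro v hv
    exact σ.exists_mfderiv_eq_of_mem_tangent (hs.mdifferentiableAt (by simp)) hp rfl
      (Eventually.of_forall fun y hy => A.localSection_orbitProj hy) hv
  · exact τ.mfderiv_mem_tangent ho (Eventually.of_forall fun g => MulAction.mem_orbit q g)
      (one_smul G q)
  · intro v hv
    refine τ.exists_mfderiv_eq_of_mem_tangent (ho.mdifferentiableAt (by simp)) hρ
      (by simp) (Eventually.of_forall ?_) hv
    rintro _ ⟨g, rfl⟩
    exact congrArg (· • q) (hρo g)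
  · exact mfderiv_apply_mfderiv_of_leftInverse (hs.mdifferentiableAt (by simp)) hp hsq
      (hmem'.mono fun b hb => A.orbitProj_localSection hb)
  · exact mfderiv_apply_mfderiv_of_leftInverse (ho.mdifferentiableAt (by simp)) hρ (one_smul G q)
      (Eventually.of_forall hρo)
  · exact mfderiv_apply_mfderiv_of_comp_const (ho.mdifferentiableAt (by simp)) hp (one_smul G q)
      (c := orbitProj G q) fun g => orbitProj_smul g q

/-- The only common point is `q`, where complementarity of the tangent spaces gives transversality.
-/
theorem intersectTransversely [ContMDiffSMul IG IQ ∞ G Q]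
    (hπ : IsPrincipalBundle IG IQ IB G Q) (A : DiscreteConnection IQ IB G Q) (q : Q) {d e : ℕ}
    (σ : SubmanifoldStructure IQ (A.slice q) d)
    (τ : SubmanifoldStructure IQ (MulAction.orbit G q) e) : σ.IntersectTransversely τ := by
  let := σ.charts
  refine ⟨σ.isSmoothEmbedding.contMDiff, ?_⟩
  rintro ⟨x, hx⟩ hxq
  have hmem : x ∈ A.slice q ∩ MulAction.orbit G q := ⟨hx, hxq⟩
  rw [A.slice_inter_orbit] at hmem
  obtain rfl : x = q := hmem
  exact (isCompl_tangent hπ A x σ τ).sup_eq_top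

end Bundle

end DiscreteConnection

/-! ### The proposition. -/

theorem mainTheorem4 {EG HG EQ HQ EB HB : Type*}
    [NormedAddCommGroup EG] [NormedSpace ℝ EG] [FiniteDimensional ℝ EG] [TopologicalSpace HG]
    [NormedAddCommGroup EQ] [NormedSpace ℝ EQ] [FiniteDimensional ℝ EQ] [TopologicalSpace HQ]
    [NormedAddCommGroup EB] [NormedSpace ℝ EB] [FiniteDimensional ℝ EB] [TopologicalSpace HB]
    (IG : ModelWithCorners ℝ EG HG) [IG.Boundaryless]
    (IQ : ModelWithCorners ℝ EQ HQ) [IQ.Boundaryless]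
    (IB : ModelWithCorners ℝ EB HB) [IB.Boundaryless]
    (G Q : Type*) [TopologicalSpace G] [ChartedSpace HG G] [Group G] [LieGroup IG ∞ G]
    [TopologicalSpace Q] [ChartedSpace HQ Q] [IsManifold IQ ∞ Q]
    [MulAction G Q] [ContMDiffSMul IG IQ ∞ G Q]
    [ChartedSpace HB (MulAction.orbitRel.Quotient G Q)]
    [IsManifold IB ∞ (MulAction.orbitRel.Quotient G Q)]
    (hπ : IsPrincipalBundle IG IQ IB G Q)
    (A : DiscreteConnection IQ IB G Q) :
    -- the three sets are open
    (IsOpen A.domain ∧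
      IsOpen (Prod.map id (orbitProj G) '' A.Hor) ∧
      IsOpen (Prod.map (orbitProj G) (orbitProj G) '' A.Hor)) ∧
    -- invariance of the domain, and its description as a preimage
    ((∀ (g₀ g₁ : G) (q₀ q₁ : Q), (q₀, q₁) ∈ A.domain → (g₀ • q₀, g₁ • q₁) ∈ A.domain) ∧
      A.domain = Prod.map (orbitProj G) (orbitProj G) ⁻¹'
        (Prod.map (orbitProj G) (orbitProj G) '' A.Hor)) ∧
    -- transversality of the maps `i_q`, and the slices
    (∀ q : Q,
      SubmanifoldStructure.IsTransversal IQ (fun q' : Q => (q, q')) A.submanifold ∧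
      Module.finrank ℝ EG ≤ Module.finrank ℝ EQ ∧
      Nonempty (SubmanifoldStructure IQ (A.slice q)
        (Module.finrank ℝ EQ - Module.finrank ℝ EG))) ∧
    -- slices and orbits: for every submanifold structure on the slice and on the orbit
    (∀ q : Q,
      A.slice q ∩ MulAction.orbit G q = {q} ∧
      Nonempty (SubmanifoldStructure IQ (MulAction.orbit G q) (Module.finrank ℝ EG)) ∧
      ∀ (d e : ℕ) (σ : SubmanifoldStructure IQ (A.slice q) d)
        (τ : SubmanifoldStructure IQ (MulAction.orbit G q) e),
        σ.IntersectTransversely τ ∧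
        IsCompl (σ.tangent ⟨q, A.self_mem_slice q⟩)
          (τ.tangent ⟨q, MulAction.mem_orbit_self q⟩)) := by
  have : ContinuousSMul G Q := ContMDiffSMul.continuousSMul (I := IG) (I' := IQ) ∞
  have : IsManifold IG ∞ G := (inferInstance : ContMDiffMul IG ∞ G).toIsManifold
  refine ⟨⟨A.isOpen_domain, A.isOpen_mixedDomain, A.isOpen_image_prodMap_orbitProj⟩,
    ⟨fun g₀ g₁ q₀ q₁ h => A.smul_mem_domain g₀ g₁ h, A.domain_eq_preimage⟩, fun q => ?_, fun q => ?_⟩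
  · exact ⟨A.isTransversal_mk q, by have := hπ.finrank_add_finrank q; omega,
      DiscreteConnection.nonempty_submanifoldStructure_slice hπ A q⟩
  · exact ⟨A.slice_inter_orbit q, hπ.nonempty_submanifoldStructure_orbit q, fun d e σ τ =>
      ⟨DiscreteConnection.intersectTransversely hπ A q σ τ,
        DiscreteConnection.isCompl_tangent hπ A q σ τ⟩⟩
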